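/- Let $n, m \ge 1$. For $i = 1,\dots,m$ let $f_i \colon \mathbf{R}^n \to \mathbf{R}$ be continuously differentiable with $\nabla f_i$ Lipschitz continuous with constant $L_i > 0$ (Euclidean norm), let $g_i \colon \mathbf{R}^n \to \mathbf{R} \cup \{\infty\}$ be closed (lower semicontinuous), proper and convex, and put $F_i := f_i + g_i$, $F := (F_1,\dots,F_m)$, $\operatorname{dom} F := \{x : F_i(x) < \infty \text{ for all } i\}$, $L := \max_i L_i$. A function $h \colon \mathbf{R}^n \to \mathbf{R} \cup \{\infty\}$ has convexity parameter $\sigma \in \mathbf{R}$ if $h(ax+by) \le a h(x) + b h(y) - \frac{\sigma}{2}ab\|x-y\|^2$ for all $x, y$ and all $a, b \ge 0$ with $a + b = 1$; it is strongly convex if it has some convexity parameter $\sigma > 0$. Let $f_i$ and $g_i$ have convexity parameters $\mu_i \in \mathbf{R}$ and $\nu_i \in \mathbf{R}$, respectively, and write $\mu := \min_i \mu_i$, $\nu := \min_i \nu_i$. Assume that every $F_i$ is strongly convex, that $\ell > L$, and that $\ell + \nu > 0$ (which is automatic if all $\nu_i \ge 0$, or if $\mu_i + \nu_i > 0$ for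 all $i$). Let $x^0 \in \operatorname{dom} F$ and let $(x^k)_{k \ge 0}$ be generated by the multiobjective proximal gradient method: $x^{k+1} = x^k + d^k$, where $$ d^k \in \operatorname*{argmin}_{d \in \mathbf{R}^n} \Big\{ \max_{1 \le i \le m} \big\{ \nabla f_i(x^k)^\top d + g_i(x^k + d) - g_i(x^k) \big\} + \frac{\ell}{2} \|d\|^2 \Big\} $$ (a run that stops because $d^k = 0$ is continued as a constant sequence). Then $\frac{\ell - \mu}{\ell + \nu} \ge 0$, and there exists a Pareto optimal point $x^\ast \in \operatorname{dom} F$ (that is, there is no $y \in \mathbf{R}^n$ with $F(y) \le F(x^\ast)$ componentwise and $F(y) \ne F(x^\ast)$) such that for all $k \ge 0$ $$ \|x^{k+1} - x^\ast\| \le \sqrt{\frac{\ell-\mu}{\ell+\nu}}\; \|x^k - x^\ast\|, $$ and thus, for all $k \ge 0$, $$ \|x^k - x^\ast\| \le \Big(\sqrt{\frac{\ell-\mu}{\ell+\nu}}\Big)^{k} \|x^0 - x^\ast\|. $$ Moreover, if $\mu + \nu > 0$, then $\sqrt{(\ell-\mu)/(\ell+\nu)} < 1$, so that the iterates converge linearly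 to $x^\ast$. -/

import Mathlib

namespace ProxGrad

/-- Closed and proper function with values in `ℝ ∪ {∞}`, modelled as an `EReal`-valued function
that never takes the value `⊥`; closed means lower semicontinuous. -/
structure IsClosedProper {n : ℕ} (h : EuclideanSpace ℝ (Fin n) → EReal) : Prop where
  ne_bot : ∀ x, h x ≠ ⊥
  exists_ne_top : ∃ x, h x ≠ ⊤
  lsc : LowerSemicontinuous h

/-- `h : ℝⁿ → ℝ ∪ {∞}` has convexity parameter `σ ∈ ℝ`:
`h (a x + b y) ≤ a h x + b h y - (σ / 2) a b ‖x - y‖ ^ 2` whenever `a, b ≥ 0`, `a + b = 1`,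
that is, `h - (σ / 2) ‖·‖ ^ 2` is convex. -/
def HasConvexityParam {n : ℕ} (h : EuclideanSpace ℝ (Fin n) → EReal) (σ : ℝ) : Prop :=
  ∀ (x y : EuclideanSpace ℝ (Fin n)) (a b : ℝ), 0 ≤ a → 0 ≤ b → a + b = 1 →
    h (a • x + b • y) + ((a * b * (σ / 2 * ‖x - y‖ ^ 2) : ℝ) : EReal) ≤
      (a : EReal) * h x + (b : EReal) * h y

/-- For finite functions this is Mathlib's notion. -/
theorem hasConvexityParam_coe_iff {n : ℕ} (h : EuclideanSpace ℝ (Fin n) → ℝ) (σ : ℝ) :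
    HasConvexityParam (fun x => (h x : EReal)) σ ↔ StrongConvexOn Set.univ σ h := by
  have key : ∀ (x y : EuclideanSpace ℝ (Fin n)) (a b : ℝ),
      (((h (a • x + b • y) : ℝ) : EReal) + ((a * b * (σ / 2 * ‖x - y‖ ^ 2) : ℝ) : EReal) ≤
        (a : EReal) * (h x : EReal) + (b : EReal) * (h y : EReal)) ↔
      h (a • x + b • y) ≤ a • h x + b • h y - a * b * (σ / 2 * ‖x - y‖ ^ 2) := by
    intro x y a b
    rw [← EReal.coe_add, ← EReal.coe_mul, ← EReal.coe_mul, ← EReal.coe_add, EReal.coe_le_coe_iff,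
      le_sub_iff_add_le]
    rfl
  constructor
  · intro H
    exact ⟨convex_univ, fun x _ y _ a b ha hb hab => (key x y a b).1 (H x y a b ha hb hab)⟩
  · intro H x y a b ha hb hab
    exact (key x y a b).2 (H.2 (Set.mem_univ x) (Set.mem_univ y) ha hb hab)

/-- The objective functions `F i = f i + g i`. -/
noncomputable def objective {n m : ℕ} (f : Fin m → EuclideanSpace ℝ (Fin n) → ℝ)
    (g : Fin m → EuclideanSpace ℝ (Fin n) → EReal) (i : Fin m)
    (x : EuclideanSpace ℝ (Fin n)) : EReal :=
  (f i x : EReal) + g i x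

/-- The effective domain of a vector-valued function `F`. -/
def effDomain {n m : ℕ} (F : Fin m → EuclideanSpace ℝ (Fin n) → EReal) :
    Set (EuclideanSpace ℝ (Fin n)) :=
  {x | ∀ i, F i x < ⊤}

/-- `x` is Pareto optimal for `min F`: no `y` satisfies `F y ≤ F x` and `F y ≠ F x`. -/
def IsParetoOptimal {n m : ℕ} (F : Fin m → EuclideanSpace ℝ (Fin n) → EReal)
    (x : EuclideanSpace ℝ (Fin n)) : Prop :=
  ¬ ∃ y, (∀ i, F i y ≤ F i x) ∧ (fun i => F i y) ≠ (fun i => F i x)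

/-- `ψ_x(d) = max_i {∇f_i(x)ᵀ d + g_i(x + d) - g_i(x)}`, used only at points `x` where all the
`g_i(x)` are finite. -/
noncomputable def psi {n m : ℕ} (f : Fin m → EuclideanSpace ℝ (Fin n) → ℝ)
    (g : Fin m → EuclideanSpace ℝ (Fin n) → EReal) (x d : EuclideanSpace ℝ (Fin n)) : EReal :=
  ⨆ i, (((inner ℝ (gradient (f i) x) d : ℝ) : EReal) + (g i (x + d) - g i x))

/-- `x 0, x 1, …` are iterates of the multiobjective proximal gradient method with constant `ℓ`:
`x 0 ∈ dom F` and `x (k + 1) = x k + d` with `d` a minimizer of `ψ_{x k}(d) + (ℓ / 2) ‖d‖ ^ 2`.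
A run that stops because `d = 0` is continued by the constant sequence. -/
structure IsIterates {n m : ℕ} (f : Fin m → EuclideanSpace ℝ (Fin n) → ℝ)
    (g : Fin m → EuclideanSpace ℝ (Fin n) → EReal) (ℓ : ℝ)
    (x : ℕ → EuclideanSpace ℝ (Fin n)) : Prop where
  start : x 0 ∈ effDomain (objective f g)
  step : ∀ k, ∃ d : EuclideanSpace ℝ (Fin n),
    IsMinOn (fun e => psi f g (x k) e + ((ℓ / 2 * ‖e‖ ^ 2 : ℝ) : EReal)) Set.univ d ∧
      x (k + 1) = x k + d

end ProxGrad

/-! Let `d` be the step at `x`, and suppose `F z ≤ F (x + d)`. The subproblem is strongly convex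
with modulus `ℓ + ν`, so its value at `z - x` exceeds the minimum by at least `(ℓ + ν) / 2 * ‖x + d
- z‖ ^ 2` (`isMinOn_add_sq_le`). Let `M` be the largest change `F i (x + d) - F i x`. The descent
lemma puts the minimum above `M`; the convexity of the `f i` puts `psi` at `z - x` below `M - μ / 2
* ‖z - x‖ ^ 2`. Then `M` cancels, leaving the contraction in `step_contraction`.

It remains to find one Pareto point below all iterates. Objectives never increase, so the sublevel
sets of the iterates are nested, and strong convexity makes them compact; a minimizer of one
component on their intersection works (`exists_isParetoOptimal_le`). -/

namespace ProxGrad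

open Filter Topology Set

variable {n m : ℕ}

/-! ### Smooth functions: first-order bounds -/

/-- The derivative of a differentiable function along a line. -/
theorem hasDerivAt_comp_line {f : EuclideanSpace ℝ (Fin n) → ℝ} (hf : Differentiable ℝ f)
    (x v : EuclideanSpace ℝ (Fin n)) (t : ℝ) :
    HasDerivAt (fun s : ℝ => f (x + s • v)) (inner ℝ (gradient f (x + t • v)) v) t := by
  have h1 : HasDerivAt (fun s : ℝ => x + s • v) v t := by
    simpa using ((hasDerivAt_id t).smul_const v).const_add x
  have h2 := (hf (x + t • v)).hasGradientAt.hasFDerivAt.comp_hasDerivAt t h1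
  exact h2.congr_deriv (by simp)

/-- First-order characterization of strong convexity. -/
theorem add_inner_gradient_add_le {f : EuclideanSpace ℝ (Fin n) → ℝ} (hf : Differentiable ℝ f)
    {μ : ℝ} (hμ : StrongConvexOn univ μ f) (x y : EuclideanSpace ℝ (Fin n)) :
    f x + inner ℝ (gradient f x) (y - x) + μ / 2 * ‖y - x‖ ^ 2 ≤ f y := by
  -- Divide the convexity inequality on the segment from `x` to `y` by `t` and let `t` decrease to
  -- `0`.
  have hd := hasDerivAt_comp_line hf x (y - x) 0
  rw [zero_smul, add_zero] at hd
  have hlim := hd.tendsto_slope_zero_right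
  have hrhs : Tendsto (fun t : ℝ => f y - f x - (1 - t) * (μ / 2 * ‖y - x‖ ^ 2)) (𝓝[>] 0)
      (𝓝 (f y - f x - (1 - 0) * (μ / 2 * ‖y - x‖ ^ 2))) :=
    (Continuous.tendsto (by fun_prop) 0).mono_left nhdsWithin_le_nhds
  have hle := le_of_tendsto_of_tendsto hlim hrhs (by
    filter_upwards [Ioo_mem_nhdsGT (zero_lt_one' ℝ)] with t ht
    have hc := hμ.2 (mem_univ x) (mem_univ y) (sub_nonneg.2 ht.2.le) ht.1.le (by ring)
    have hp : (1 - t) • x + t • y = x + t • (y - x) := by module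
    rw [hp, norm_sub_rev] at hc
    simp only [smul_eq_mul, zero_add, zero_smul, add_zero] at hc ⊢
    rw [inv_mul_le_iff₀ ht.1]
    linarith)
  linarith

/-- The descent lemma for functions with Lipschitz gradient. -/
theorem le_add_inner_gradient_add {f : EuclideanSpace ℝ (Fin n) → ℝ} (hf : Differentiable ℝ f)
    {L : NNReal} (hL : LipschitzWith L (gradient f)) (x v : EuclideanSpace ℝ (Fin n)) :
    f (x + v) ≤ f x + inner ℝ (gradient f x) v + L / 2 * ‖v‖ ^ 2 := by
  have hd : ∀ t : ℝ, HasDerivAt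
      (fun s : ℝ => f (x + s • v) - s * inner ℝ (gradient f x) v - s ^ 2 * (L / 2 * ‖v‖ ^ 2))
      (inner ℝ (gradient f (x + t • v)) v - inner ℝ (gradient f x) v - t * (L * ‖v‖ ^ 2)) t := by
    intro t
    have h1 := ((hasDerivAt_comp_line hf x v t).sub
      ((hasDerivAt_id t).mul_const (inner ℝ (gradient f x) v))).sub
      (((hasDerivAt_id t).pow 2).mul_const (L / 2 * ‖v‖ ^ 2))
    refine h1.congr_deriv ?_
    simp only [id_eq, Nat.cast_ofNat, Nat.add_one_sub_one, pow_one]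
    ring
  have hanti := antitoneOn_of_deriv_nonpos (convex_Icc (0 : ℝ) 1)
    (fun t _ => (hd t).continuousAt.continuousWithinAt)
    (fun t _ => (hd t).differentiableAt.differentiableWithinAt) (fun t ht => by
      rw [interior_Icc] at ht
      rw [(hd t).deriv, ← inner_sub_left, sub_nonpos]
      calc inner ℝ (gradient f (x + t • v) - gradient f x) v
          ≤ ‖gradient f (x + t • v) - gradient f x‖ * ‖v‖ := real_inner_le_norm _ _
        _ ≤ (L * ‖x + t • v - x‖) * ‖v‖ := by
          gcongr
          exact hL.norm_sub_le _ _
        _ = t * (L * ‖v‖ ^ 2) := by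
          rw [add_sub_cancel_left, norm_smul, Real.norm_of_nonneg ht.1.le]
          ring)
  have h := hanti (left_mem_Icc.2 zero_le_one) (right_mem_Icc.2 zero_le_one) zero_le_one
  simp only [one_smul, zero_smul, add_zero] at h
  linarith

/-- A convexity parameter of a smooth function is at most the Lipschitz constant of its
gradient. -/
theorem convexityParam_le_lipschitz (hn : 0 < n) {f : EuclideanSpace ℝ (Fin n) → ℝ}
    (hf : Differentiable ℝ f) {L : NNReal} (hL : LipschitzWith L (gradient f)) {μ : ℝ}
    (hμ : StrongConvexOn univ μ f) : μ ≤ L := by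
  -- A unit vector, available because `0 < n`, makes the two quadratic bounds directly comparable.
  have h1 := add_inner_gradient_add_le hf hμ 0 (0 + EuclideanSpace.single ⟨0, hn⟩ 1)
  have h2 := le_add_inner_gradient_add hf hL 0 (EuclideanSpace.single ⟨0, hn⟩ 1)
  simp only [add_sub_cancel_left, PiLp.norm_single, norm_one, one_pow, mul_one]
    at h1 h2
  linarith

/-! ### Extended-valued convex functions -/

theorem HasConvexityParam.apply_le {h : EuclideanSpace ℝ (Fin n) → EReal} {σ : ℝ}
    (hσ : HasConvexityParam h σ) {x y : EuclideanSpace ℝ (Fin n)} {r s : ℝ} (hr : h x ≤ r)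
    (hs : h y ≤ s) {a b : ℝ} (ha : 0 ≤ a) (hb : 0 ≤ b) (hab : a + b = 1) :
    h (a • x + b • y) ≤ ((a * r + b * s - a * b * (σ / 2 * ‖x - y‖ ^ 2) : ℝ) : EReal) := by
  have h1 : h (a • x + b • y) + ((a * b * (σ / 2 * ‖x - y‖ ^ 2) : ℝ) : EReal) ≤
      ((a * r + b * s : ℝ) : EReal) := by
    refine (hσ x y a b ha hb hab).trans ?_
    rw [EReal.coe_add, EReal.coe_mul, EReal.coe_mul]
    exact add_le_add (mul_le_mul_of_nonneg_left hr (EReal.coe_nonneg.2 ha))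
      (mul_le_mul_of_nonneg_left hs (EReal.coe_nonneg.2 hb))
  rw [EReal.coe_sub]
  exact (EReal.le_sub_iff_add_le (.inl (EReal.coe_ne_bot _)) (.inl (EReal.coe_ne_top _))).2 h1

theorem lowerSemicontinuous_objective {f : Fin m → EuclideanSpace ℝ (Fin n) → ℝ}
    {g : Fin m → EuclideanSpace ℝ (Fin n) → EReal} {i : Fin m} (hf : Continuous (f i))
    (hg : IsClosedProper (g i)) : LowerSemicontinuous (objective f g i) :=
  (continuous_coe_real_ereal.comp hf).lowerSemicontinuous.add' hg.lsc fun _ =>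
    EReal.continuousAt_add (.inl (EReal.coe_ne_top _)) (.inl (EReal.coe_ne_bot _))

theorem objective_ne_bot {f : Fin m → EuclideanSpace ℝ (Fin n) → ℝ}
    {g : Fin m → EuclideanSpace ℝ (Fin n) → EReal} {i : Fin m}
    (hg : IsClosedProper (g i)) (x : EuclideanSpace ℝ (Fin n)) : objective f g i x ≠ ⊥ := by
  simp [objective, EReal.add_eq_bot_iff, hg.ne_bot x]

theorem objective_lt_top_iff {f : Fin m → EuclideanSpace ℝ (Fin n) → ℝ}
    {g : Fin m → EuclideanSpace ℝ (Fin n) → EReal} {i : Fin m}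
    {x : EuclideanSpace ℝ (Fin n)} : objective f g i x < ⊤ ↔ g i x < ⊤ := by
  unfold objective
  induction g i x <;> simp [← EReal.coe_add, EReal.coe_lt_top]

/-- Sublevel sets of a lower semicontinuous strongly convex function are compact. -/
theorem isCompact_sublevel {h : EuclideanSpace ℝ (Fin n) → EReal} (hbot : ∀ x, h x ≠ ⊥)
    (hlsc : LowerSemicontinuous h) {σ : ℝ} (hσ : 0 < σ) (hconv : HasConvexityParam h σ) (c : ℝ) :
    IsCompact {x | h x ≤ c} := by
  rcases Set.eq_empty_or_nonempty {x | h x ≤ c} with he | ⟨x₀, hx₀⟩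
  · rw [he]
    exact isCompact_empty
  obtain ⟨p, -, hp⟩ := LowerSemicontinuousOn.exists_isMinOn
    ⟨x₀, Metric.mem_closedBall_self zero_le_one⟩ (isCompact_closedBall x₀ 1)
    (hlsc.lowerSemicontinuousOn _)
  obtain ⟨b, hb⟩ : ∃ b : ℝ, ∀ y ∈ Metric.closedBall x₀ 1, (b : EReal) ≤ h y := by
    refine ⟨(h p).toReal, fun y hy => ?_⟩
    have hpx : h p ≤ h x₀ := hp (Metric.mem_closedBall_self zero_le_one)
    rw [EReal.coe_toReal ((hpx.trans hx₀).trans_lt (EReal.coe_lt_top c)).ne (hbot p)]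
    exact hp hy
  -- For `r = ‖y - x₀‖ ≥ 1`, the point of the segment at distance `1` from `x₀` has value at least
  -- `b` and at most `c - (r - 1) * σ / 2`; this bounds `r`.
  refine (isCompact_closedBall x₀ (1 + 2 * (c - b) / σ)).of_isClosed_subset
    (hlsc.isClosed_preimage _) fun y hy => ?_
  rw [mem_closedBall_iff_norm]
  have hbc : b ≤ c := EReal.coe_le_coe_iff.1
    ((hb x₀ (Metric.mem_closedBall_self zero_le_one)).trans hx₀)
  rcases le_total ‖y - x₀‖ 1 with h1 | h1
  · have : 0 ≤ 2 * (c - b) / σ := div_nonneg (by linarith) hσ.le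
    linarith
  have hr : 0 < ‖y - x₀‖ := by linarith
  have hq := hconv.apply_le hy hx₀ (inv_nonneg.2 hr.le) (sub_nonneg.2 (inv_le_one_of_one_le₀ h1))
    (add_sub_cancel _ _)
  have hq' := (hb _ (by
    rw [mem_closedBall_iff_norm]
    have : ‖y - x₀‖⁻¹ • y + (1 - ‖y - x₀‖⁻¹) • x₀ - x₀ = ‖y - x₀‖⁻¹ • (y - x₀) := by module
    rw [this, norm_smul, norm_inv, norm_norm, inv_mul_cancel₀ hr.ne'])).trans hq
  rw [EReal.coe_le_coe_iff] at hq'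
  have he : ‖y - x₀‖⁻¹ * (1 - ‖y - x₀‖⁻¹) * (σ / 2 * ‖y - x₀‖ ^ 2) =
      (‖y - x₀‖ - 1) * (σ / 2) := by
    field_simp
  rw [he] at hq'
  rw [← sub_le_iff_le_add', le_div_iff₀ hσ]
  linarith

theorem HasConvexityParam.mono {h : EuclideanSpace ℝ (Fin n) → EReal} {σ τ : ℝ}
    (hσ : HasConvexityParam h σ) (hτ : τ ≤ σ) : HasConvexityParam h τ := by
  intro x y a b ha hb hab
  refine le_trans (add_le_add le_rfl (EReal.coe_le_coe_iff.2 ?_)) (hσ x y a b ha hb hab)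
  gcongr

/-! ### The proximal subproblem -/

/-- The terms of `psi` at points where all functions are finite. -/
theorem coe_inner_add_sub {g : EuclideanSpace ℝ (Fin n) → EReal} (hg : ∀ x, g x ≠ ⊥)
    {x y : EuclideanSpace ℝ (Fin n)} (hx : g x < ⊤) (hy : g y < ⊤) (r : ℝ) :
    (r : EReal) + (g y - g x) = ((r + ((g y).toReal - (g x).toReal) : ℝ) : EReal) := by
  rw [EReal.coe_add, EReal.coe_sub, EReal.coe_toReal hy.ne (hg y), EReal.coe_toReal hx.ne (hg x)]

/-- Real-valued form of the minimization property defining a step of the method. -/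
theorem exists_real_bound_of_isMinOn (hm : 0 < m) {f : Fin m → EuclideanSpace ℝ (Fin n) → ℝ}
    {g : Fin m → EuclideanSpace ℝ (Fin n) → EReal} (hg : ∀ i x, g i x ≠ ⊥) {ℓ : ℝ}
    {x d : EuclideanSpace ℝ (Fin n)} (hx : ∀ i, g i x < ⊤)
    (hd : IsMinOn (fun e => psi f g x e + ((ℓ / 2 * ‖e‖ ^ 2 : ℝ) : EReal)) univ d) :
    (∀ i, g i (x + d) < ⊤) ∧ ∃ a : ℝ,
      (∀ i, inner ℝ (gradient (f i) x) d + ((g i (x + d)).toReal - (g i x).toReal) ≤ a) ∧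
      ∀ e c, (∀ i, g i (x + e) < ⊤) →
        (∀ i, inner ℝ (gradient (f i) x) e + ((g i (x + e)).toReal - (g i x).toReal) ≤ c) →
        a + ℓ / 2 * ‖d‖ ^ 2 ≤ c + ℓ / 2 * ‖e‖ ^ 2 := by
  have hpsi : ∀ e (c : ℝ), (∀ i, g i (x + e) < ⊤) →
      (∀ i, inner ℝ (gradient (f i) x) e + ((g i (x + e)).toReal - (g i x).toReal) ≤ c) →
      psi f g x e ≤ c := fun e c he hc => iSup_le fun i => by
    rw [coe_inner_add_sub (hg i) (hx i) (he i)]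
    exact EReal.coe_le_coe_iff.2 (hc i)
  have hmin : ∀ e (c : ℝ), psi f g x e ≤ c →
      psi f g x d + ((ℓ / 2 * ‖d‖ ^ 2 : ℝ) : EReal) ≤ ((c + ℓ / 2 * ‖e‖ ^ 2 : ℝ) : EReal) :=
    fun e c he => (hd (mem_univ e)).trans (by
      rw [EReal.coe_add]
      exact add_le_add he le_rfl)
  -- The zero displacement is a competitor with value at most `0`, so the minimum is not `⊤`.
  have h0 : psi f g x d + ((ℓ / 2 * ‖d‖ ^ 2 : ℝ) : EReal) < ⊤ :=
    (hmin 0 0 (hpsi 0 0 (by simpa using hx) (by simp))).trans_lt (EReal.coe_lt_top _)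
  have htop : psi f g x d < ⊤ := by
    by_contra h
    rw [not_lt_top_iff] at h
    rw [h, EReal.top_add_coe] at h0
    exact lt_irrefl _ h0
  have hfin : ∀ i, g i (x + d) < ⊤ := by
    intro i
    by_contra h
    rw [not_lt_top_iff] at h
    have hi : ((inner ℝ (gradient (f i) x) d : ℝ) : EReal) + (g i (x + d) - g i x) ≤
      psi f g x d := le_iSup (fun i => ((inner ℝ (gradient (f i) x) d : ℝ) : EReal) +
        (g i (x + d) - g i x)) i
    rw [h, ← EReal.coe_toReal (hx i).ne (hg i x), EReal.top_sub_coe, EReal.coe_add_top] at hi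
    exact absurd htop (not_lt.2 hi)
  have hle : ∀ i, ((inner ℝ (gradient (f i) x) d + ((g i (x + d)).toReal - (g i x).toReal) : ℝ) :
      EReal) ≤ psi f g x d := fun i => by
    rw [← coe_inner_add_sub (hg i) (hx i) (hfin i)]
    exact le_iSup (fun i => ((inner ℝ (gradient (f i) x) d : ℝ) : EReal) +
        (g i (x + d) - g i x)) i
  have ha : ((psi f g x d).toReal : EReal) = psi f g x d :=
    EReal.coe_toReal htop.ne (((EReal.bot_lt_coe _).trans_le (hle ⟨0, hm⟩)).ne')
  refine ⟨hfin, (psi f g x d).toReal, fun i => ?_, fun e c he hc => ?_⟩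
  · rw [← EReal.coe_le_coe_iff, ha]
    exact hle i
  · have h := hmin e c (hpsi e c he hc)
    rwa [← ha, ← EReal.coe_add, EReal.coe_le_coe_iff] at h

/-- The three-point inequality for a step of the method, from strong convexity of the
subproblem. -/
theorem isMinOn_add_sq_le (hm : 0 < m) {f : Fin m → EuclideanSpace ℝ (Fin n) → ℝ}
    {g : Fin m → EuclideanSpace ℝ (Fin n) → EReal} (hg : ∀ i x, g i x ≠ ⊥) {ℓ ν : ℝ}
    (hν : ∀ i, HasConvexityParam (g i) ν)
    {x d : EuclideanSpace ℝ (Fin n)} (hx : ∀ i, g i x < ⊤)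
    (hd : IsMinOn (fun e => psi f g x e + ((ℓ / 2 * ‖e‖ ^ 2 : ℝ) : EReal)) univ d) :
    (∀ i, g i (x + d) < ⊤) ∧ ∃ a : ℝ,
      (∀ i, inner ℝ (gradient (f i) x) d + ((g i (x + d)).toReal - (g i x).toReal) ≤ a) ∧
      ∀ e c, (∀ i, g i (x + e) < ⊤) →
        (∀ i, inner ℝ (gradient (f i) x) e + ((g i (x + e)).toReal - (g i x).toReal) ≤ c) →
        a + ℓ / 2 * ‖d‖ ^ 2 + (ℓ + ν) / 2 * ‖d - e‖ ^ 2 ≤ c + ℓ / 2 * ‖e‖ ^ 2 := by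
  obtain ⟨hfin, a, ha, hmin⟩ := exists_real_bound_of_isMinOn hm hg hx hd
  refine ⟨hfin, a, ha, fun e c he hc => ?_⟩
  -- Compare `d` with the point `(1 - t) • d + t • e`, cancel a factor `t`, then let `t` tend to
  -- `0`. No sign of `ℓ + ν` is needed.
  have key : ∀ t ∈ Ioo (0 : ℝ) 1, a + ℓ / 2 * ‖d‖ ^ 2 + (1 - t) * ((ℓ + ν) / 2 * ‖d - e‖ ^ 2) ≤
      c + ℓ / 2 * ‖e‖ ^ 2 := by
    intro t ht
    have hseg : ∀ i, g i (x + ((1 - t) • d + t • e)) ≤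
        (((1 - t) * (g i (x + d)).toReal + t * (g i (x + e)).toReal -
          (1 - t) * t * (ν / 2 * ‖d - e‖ ^ 2) : ℝ) : EReal) := by
      intro i
      have h := (hν i).apply_le (EReal.coe_toReal (hfin i).ne (hg i _)).ge
        (EReal.coe_toReal (he i).ne (hg i _)).ge (sub_nonneg.2 ht.2.le) ht.1.le (by ring)
      have hp : (1 - t) • (x + d) + t • (x + e) = x + ((1 - t) • d + t • e) := by module
      rwa [hp, add_sub_add_left_eq_sub] at h
    have hseg' : ∀ i, g i (x + ((1 - t) • d + t • e)) < ⊤ :=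
      fun i => (hseg i).trans_lt (EReal.coe_lt_top _)
    have h := hmin ((1 - t) • d + t • e)
      ((1 - t) * a + t * c - (1 - t) * t * (ν / 2 * ‖d - e‖ ^ 2)) hseg' (fun i => by
        have h1 := hseg i
        rw [← EReal.coe_toReal (hseg' i).ne (hg i _), EReal.coe_le_coe_iff] at h1
        rw [inner_add_right, inner_smul_right, inner_smul_right]
        have h2 := mul_le_mul_of_nonneg_left (ha i) (sub_nonneg.2 ht.2.le)
        have h3 := mul_le_mul_of_nonneg_left (hc i) ht.1.le
        linarith)
    have hnorm : ‖(1 - t) • d + t • e‖ ^ 2 =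
        (1 - t) * ‖d‖ ^ 2 + t * ‖e‖ ^ 2 - (1 - t) * t * ‖d - e‖ ^ 2 := by
      rw [norm_add_sq_real, norm_sub_sq_real, norm_smul, norm_smul, inner_smul_left,
        inner_smul_right, mul_pow, mul_pow, Real.norm_eq_abs, Real.norm_eq_abs, sq_abs, sq_abs]
      simp only [conj_trivial]
      ring
    rw [hnorm] at h
    refine le_of_mul_le_mul_left ?_ ht.1
    linarith
  have hlim : Tendsto (fun t : ℝ => a + ℓ / 2 * ‖d‖ ^ 2 +
      (1 - t) * ((ℓ + ν) / 2 * ‖d - e‖ ^ 2)) (𝓝[>] 0)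
      (𝓝 (a + ℓ / 2 * ‖d‖ ^ 2 + (1 - 0) * ((ℓ + ν) / 2 * ‖d - e‖ ^ 2))) :=
    (Continuous.tendsto (by fun_prop) 0).mono_left nhdsWithin_le_nhds
  have h := le_of_tendsto hlim (by
    filter_upwards [Ioo_mem_nhdsGT (zero_lt_one' ℝ)] with t ht using key t ht)
  linarith

theorem objective_eq_coe {f : Fin m → EuclideanSpace ℝ (Fin n) → ℝ}
    {g : Fin m → EuclideanSpace ℝ (Fin n) → EReal} (hg : ∀ i x, g i x ≠ ⊥) {i : Fin m}
    {x : EuclideanSpace ℝ (Fin n)} (hx : g i x < ⊤) :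
    objective f g i x = ((f i x + (g i x).toReal : ℝ) : EReal) := by
  rw [objective, EReal.coe_add, EReal.coe_toReal hx.ne (hg i x)]

/-- A step of the method stays in the domain, does not increase any objective, and contracts the
distance to every point whose objective values are not larger than those reached by the step. -/
theorem step_contraction (hm : 0 < m) {f : Fin m → EuclideanSpace ℝ (Fin n) → ℝ}
    {g : Fin m → EuclideanSpace ℝ (Fin n) → EReal} (hf : ∀ i, Differentiable ℝ (f i))
    {L : Fin m → NNReal} (hfL : ∀ i, LipschitzWith (L i) (gradient (f i)))
    (hg : ∀ i x, g i x ≠ ⊥) {ℓ μ ν : ℝ}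
    (hLℓ : ∀ i, (L i : ℝ) ≤ ℓ) (hμ : ∀ i, StrongConvexOn univ μ (f i))
    (hν : ∀ i, HasConvexityParam (g i) ν) {x d : EuclideanSpace ℝ (Fin n)}
    (hx : ∀ i, g i x < ⊤)
    (hd : IsMinOn (fun e => psi f g x e + ((ℓ / 2 * ‖e‖ ^ 2 : ℝ) : EReal)) univ d) :
    (∀ i, g i (x + d) < ⊤) ∧ (∀ i, objective f g i (x + d) ≤ objective f g i x) ∧
      ∀ z, (∀ i, objective f g i z ≤ objective f g i (x + d)) →
        (ℓ + ν) * ‖x + d - z‖ ^ 2 ≤ (ℓ - μ) * ‖x - z‖ ^ 2 := by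
  obtain ⟨hfin, a, ha, hmin⟩ := isMinOn_add_sq_le hm hg hν hx hd
  have hdesc : ∀ i, f i (x + d) + (g i (x + d)).toReal - (f i x + (g i x).toReal) ≤
      a + ℓ / 2 * ‖d‖ ^ 2 := by
    intro i
    have h1 := le_add_inner_gradient_add (hf i) (hfL i) x d
    have h2 := mul_le_mul_of_nonneg_right (hLℓ i) (sq_nonneg ‖d‖)
    have h3 := ha i
    linarith
  refine ⟨hfin, fun i => ?_, fun z hz => ?_⟩
  -- The plain minimality bound is used because `ℓ + ν` has no assumed sign here.
  · obtain ⟨-, a', ha', hmin'⟩ := exists_real_bound_of_isMinOn hm hg hx hd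
    have h0 := hmin' 0 0 (by simpa using hx) (by simp)
    rw [objective_eq_coe hg (hfin i), objective_eq_coe hg (hx i), EReal.coe_le_coe_iff]
    have h1 := le_add_inner_gradient_add (hf i) (hfL i) x d
    have h2 := mul_le_mul_of_nonneg_right (hLℓ i) (sq_nonneg ‖d‖)
    have h3 := ha' i
    simp only [norm_zero] at h0
    linarith
  · have hzfin : ∀ i, g i z < ⊤ := fun i => objective_lt_top_iff.1
      ((hz i).trans_lt (objective_lt_top_iff.2 (hfin i)))
    have : Nonempty (Fin m) := ⟨⟨0, hm⟩⟩
    -- The maximal change at `j` enters both the upper bound at `z - x` and the lower bound `hdesc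
    -- j`, so it cancels.
    obtain ⟨j, hj⟩ := Finite.exists_max
      fun i => f i (x + d) + (g i (x + d)).toReal - (f i x + (g i x).toReal)
    have h := hmin (z - x) (f j (x + d) + (g j (x + d)).toReal - (f j x + (g j x).toReal) -
      μ / 2 * ‖z - x‖ ^ 2) (by simpa using hzfin) (fun i => by
        rw [add_sub_cancel]
        have h1 := add_inner_gradient_add_le (hf i) (hμ i) x z
        have h2 := hz i
        rw [objective_eq_coe hg (hfin i), objective_eq_coe hg (hzfin i),
          EReal.coe_le_coe_iff] at h2
        have h3 := hj i
        linarith)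
    have h4 := hdesc j
    have h5 : d - (z - x) = x + d - z := by abel
    rw [h5, norm_sub_rev z x] at h
    linarith

/-! ### A Pareto point below the iterates -/

/-- If all components of `F` are closed and strongly convex, then below every sequence with
nonincreasing objective values there is a Pareto optimal point. -/
theorem exists_isParetoOptimal_le (hm : 0 < m) {F : Fin m → EuclideanSpace ℝ (Fin n) → EReal}
    (hbot : ∀ i x, F i x ≠ ⊥) (hlsc : ∀ i, LowerSemicontinuous (F i))
    (hF : ∀ i, ∃ σ : ℝ, 0 < σ ∧ HasConvexityParam (F i) σ)
    {x : ℕ → EuclideanSpace ℝ (Fin n)} (hx : x 0 ∈ effDomain F)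
    (hanti : ∀ k i, F i (x (k + 1)) ≤ F i (x k)) :
    ∃ z ∈ effDomain F, IsParetoOptimal F z ∧ ∀ k i, F i z ≤ F i (x k) := by
  have hanti' : ∀ i, Antitone fun k => F i (x k) := fun i =>
    antitone_nat_of_succ_le fun k => hanti k i
  have hfin : ∀ k i, F i (x k) < ⊤ := fun k i => (hanti' i (Nat.zero_le k)).trans_lt (hx i)
  have hcoe : ∀ k i, (((F i (x k)).toReal : ℝ) : EReal) = F i (x k) := fun k i =>
    EReal.coe_toReal (hfin k i).ne (hbot i _)
  have hcl : ∀ k, IsClosed {y | ∀ i, F i y ≤ F i (x k)} := fun k => by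
    rw [ofPred_forall]
    exact isClosed_iInter fun i => (hlsc i).isClosed_preimage _
  obtain ⟨σ, hσ, hconv⟩ := hF ⟨0, hm⟩
  have hcpt : IsCompact {y | ∀ i, F i y ≤ F i (x 0)} :=
    (isCompact_sublevel (hbot ⟨0, hm⟩) (hlsc _) hσ hconv (F ⟨0, hm⟩ (x 0)).toReal).of_isClosed_subset
      (hcl 0) fun y hy => by
        rw [mem_ofPred_eq, hcoe]
        exact hy _
  have hne := IsCompact.nonempty_iInter_of_sequence_nonempty_isCompact_isClosed
    (fun k => {y | ∀ i, F i y ≤ F i (x k)}) (fun k y hy i => (hy i).trans (hanti k i))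
    (fun k => ⟨x k, fun i => le_rfl⟩) hcpt hcl
  have hcptI : IsCompact (⋂ k, {y | ∀ i, F i y ≤ F i (x k)}) :=
    hcpt.of_isClosed_subset (isClosed_iInter hcl) (iInter_subset _ 0)
  obtain ⟨z, hz, hzmin⟩ := LowerSemicontinuousOn.exists_isMinOn hne hcptI
    ((hlsc ⟨0, hm⟩).lowerSemicontinuousOn _)
  rw [mem_iInter] at hz
  have hzfin : ∀ i, F i z < ⊤ := fun i => (hz 0 i).trans_lt (hfin 0 i)
  have hzcoe : ∀ i, (((F i z).toReal : ℝ) : EReal) = F i z := fun i =>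
    EReal.coe_toReal (hzfin i).ne (hbot i _)
  refine ⟨z, hzfin, ?_, hz⟩
  rintro ⟨y, hyz, hne⟩
  -- If `y` dominates `z`, the midpoint stays in the intersection and, as `y ≠ z`, strictly lowers
  -- component `0`, contradicting the choice of `z`.
  have hmid : ∀ i τ, HasConvexityParam (F i) τ → F i ((1 / 2 : ℝ) • y + (1 / 2 : ℝ) • z) ≤
      (((F i z).toReal - 1 / 2 * (1 / 2) * (τ / 2 * ‖y - z‖ ^ 2) : ℝ) : EReal) := by
    intro i τ hτ
    have h := hτ.apply_le ((hyz i).trans (hzcoe i).ge) (hzcoe i).ge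
      (a := 1 / 2) (b := 1 / 2) (by norm_num) (by norm_num) (by norm_num)
    convert h using 2
    ring
  have hmem : (1 / 2 : ℝ) • y + (1 / 2 : ℝ) • z ∈ ⋂ k, {y | ∀ i, F i y ≤ F i (x k)} := by
    rw [mem_iInter]
    intro k i
    obtain ⟨τ, hτ, hτc⟩ := hF i
    refine ((hmid i τ hτc).trans ?_).trans (hz k i)
    rw [← hzcoe i, EReal.coe_le_coe_iff, EReal.toReal_coe]
    have : 0 ≤ 1 / 2 * (1 / 2) * (τ / 2 * ‖y - z‖ ^ 2) := by positivity
    linarith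
  have h : F ⟨0, hm⟩ z ≤ _ := (hzmin hmem).trans (hmid _ σ hconv)
  rw [← hzcoe, EReal.coe_le_coe_iff, EReal.toReal_coe] at h
  have hyne : y ≠ z := fun h => hne (by rw [h])
  have : 0 < ‖y - z‖ := norm_pos_iff.2 (sub_ne_zero.2 hyne)
  have : 0 < 1 / 2 * (1 / 2) * (σ / 2 * ‖y - z‖ ^ 2) := by positivity
  linarith

end ProxGrad

/-! ### Linear convergence -/

theorem mainTheorem3 {n m : ℕ} (hn : 0 < n) (hm : 0 < m)
    (f : Fin m → EuclideanSpace ℝ (Fin n) → ℝ)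
    (g : Fin m → EuclideanSpace ℝ (Fin n) → EReal)
    (hf : ∀ i, ContDiff ℝ 1 (f i))
    (L : Fin m → NNReal) (hL : ∀ i, 0 < L i)
    (hfL : ∀ i, LipschitzWith (L i) (gradient (f i)))
    (hg : ∀ i, ProxGrad.IsClosedProper (g i))
    (hg_convex : ∀ i, ProxGrad.HasConvexityParam (g i) 0)
    (μ ν : Fin m → ℝ)
    (hμ : ∀ i, StrongConvexOn Set.univ (μ i) (f i))
    (hν : ∀ i, ProxGrad.HasConvexityParam (g i) (ν i))
    (hF : ∀ i, ∃ σ : ℝ, 0 < σ ∧ ProxGrad.HasConvexityParam (ProxGrad.objective f g i) σ)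
    (ℓ : ℝ) (hℓ : (⨆ i, (L i : ℝ)) < ℓ) (hℓν : 0 < ℓ + ⨅ i, ν i)
    (x : ℕ → EuclideanSpace ℝ (Fin n)) (hx : ProxGrad.IsIterates f g ℓ x) :
    0 ≤ (ℓ - ⨅ i, μ i) / (ℓ + ⨅ i, ν i) ∧
    (0 < (⨅ i, μ i) + (⨅ i, ν i) → √((ℓ - ⨅ i, μ i) / (ℓ + ⨅ i, ν i)) < 1) ∧
    ∃ xstar : EuclideanSpace ℝ (Fin n),
      xstar ∈ ProxGrad.effDomain (ProxGrad.objective f g) ∧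
      ProxGrad.IsParetoOptimal (ProxGrad.objective f g) xstar ∧
      (∀ k, ‖x (k + 1) - xstar‖ ≤ √((ℓ - ⨅ i, μ i) / (ℓ + ⨅ i, ν i)) * ‖x k - xstar‖) ∧
      (∀ k, ‖x k - xstar‖ ≤ √((ℓ - ⨅ i, μ i) / (ℓ + ⨅ i, ν i)) ^ k * ‖x 0 - xstar‖) := by
  have : Nonempty (Fin m) := ⟨⟨0, hm⟩⟩
  have hdiff : ∀ i, Differentiable ℝ (f i) := fun i => (hf i).differentiable one_ne_zero
  have hμi : ∀ i, (⨅ i, μ i) ≤ μ i := ciInf_le (Set.finite_range μ).bddBelow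
  have hνi : ∀ i, (⨅ i, ν i) ≤ ν i := ciInf_le (Set.finite_range ν).bddBelow
  have hLi : ∀ i, (L i : ℝ) < ℓ := fun i =>
    (le_ciSup (Set.finite_range fun i => (L i : ℝ)).bddAbove i).trans_lt hℓ
  have hμ' : ∀ i, StrongConvexOn Set.univ (⨅ i, μ i) (f i) := fun i => (hμ i).mono (hμi i)
  have hν' : ∀ i, ProxGrad.HasConvexityParam (g i) (⨅ i, ν i) := fun i => (hν i).mono (hνi i)
  have hμℓ : 0 < ℓ - ⨅ i, μ i := sub_pos.2
    ((ProxGrad.convexityParam_le_lipschitz hn (hdiff ⟨0, hm⟩) (hfL ⟨0, hm⟩)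
      (hμ' ⟨0, hm⟩)).trans_lt (hLi ⟨0, hm⟩))
  have hbot : ∀ i x, g i x ≠ ⊥ := fun i => (hg i).ne_bot
  choose d hd hxd using hx.step
  have hstep := fun k (hk : ∀ i, g i (x k) < ⊤) =>
    ProxGrad.step_contraction hm hdiff hfL hbot (fun i => (hLi i).le) hμ' hν' hk (hd k)
  have hdom : ∀ k i, g i (x k) < ⊤ := by
    intro k
    induction k with
    | zero => exact fun i => ProxGrad.objective_lt_top_iff.1 (hx.start i)
    | succ k ih =>
      rw [hxd]
      exact (hstep k ih).1
  obtain ⟨z, hzdom, hzopt, hz⟩ := ProxGrad.exists_isParetoOptimal_le hm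
    (fun i => ProxGrad.objective_ne_bot (f := f) (hg i))
    (fun i => ProxGrad.lowerSemicontinuous_objective (hdiff i).continuous (hg i)) hF hx.start
    (fun k i => by
      rw [hxd]
      exact (hstep k (hdom k)).2.1 i)
  have hcontr : ∀ k, ‖x (k + 1) - z‖ ≤
      √((ℓ - ⨅ i, μ i) / (ℓ + ⨅ i, ν i)) * ‖x k - z‖ := by
    intro k
    -- The contraction compares `z` with the new iterate, hence the index `k + 1`.
    have h := (hstep k (hdom k)).2.2 z fun i => by
      rw [← hxd]
      exact hz (k + 1) i
    rw [← hxd] at h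
    refine (sq_le_sq₀ (norm_nonneg _) (by positivity)).1 ?_
    rw [mul_pow, Real.sq_sqrt (div_pos hμℓ hℓν).le, div_mul_eq_mul_div, le_div_iff₀ hℓν]
    linarith
  refine ⟨(div_pos hμℓ hℓν).le, fun hpos => ?_, z, hzdom, hzopt, hcontr, fun k => ?_⟩
  · rw [Real.sqrt_lt' one_pos, one_pow, div_lt_one hℓν]
    linarith
  · induction k with
    | zero => simp
    | succ k ih =>
      refine (hcontr k).trans ?_
      rw [pow_succ', mul_assoc]
      exact mul_le_mul_of_nonneg_left ih (Real.sqrt_nonneg _)
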